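/- Let $a>0$ and let $W=(W(t))_{t\ge 0}$ be a standard real Brownian motion (started at $0$, with almost surely continuous paths) on a probability space $(\Omega,\mathcal F,\mathbb P)$. For $\mu>0$ let $c_\mu(t)=-\mu-t/4$. The limiting diffusion $r_\mu$, driven by $W$, is defined piecewise. Set $\tau_0=0$. For $n\ge 0$, on $\{\tau_n<\infty\}$, the $n$-th piece of $r_\mu$ starts from $0$ at time $\tau_n$ and is given, for $t\ge\tau_n$, by $$Y_n(t)-Y_n(\tau_n)-\Big(\sup_{\tau_n\le s\le t}\big(Y_n(s)-Y_n(\tau_n)\big)\Big)\vee 0,\qquad Y_n(t)=W(t)+\alpha_n t,$$ where $\alpha_n=a/4$ if $n$ is even and $\alpha_n=-(a+1)/4$ if $n$ is odd; it is followed until its first hitting time $\tau_{n+1}\in(\tau_n,\infty]$ of the critical line $t\mapsto c_\mu(t)$. If $\tau_n=\infty$, then $\tau_{n+1}=\infty$. Write $\xi^+_\mu(k)=\tau_{2k+1}$, $\xi^-_\mu(k)=\tau_{2k+2}$ ($k\ge 0$), and let $$\nu^0_\mu=\sum_{k\ge 0,\ \xi^-_\mu(k)<\infty}\delta_{\xi^-_\mu(k)},$$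 a random measure on $\mathbb R_+=[0,\infty)$; the same $W$ is used for all $\mu>0$. **Proposition (Limiting point process).** There is a random measure $M_0$ on $(0,\infty)$ (a measurable map from $\Omega$ to the Borel measures on $(0,\infty)$) such that, for all fixed $0<\mu_1<\dots<\mu_k$, almost surely $$M_0[\mu_i,\infty)=\nu^0_{\mu_i}(\mathbb R_+)\qquad\text{for every } i=1,\dots,k.$$ It is almost surely unique: any other random measure on $(0,\infty)$ with this property is almost surely equal to $M_0$. Moreover, almost surely, $M_0$ is discrete (a sum of Dirac masses with integer multiplicities, with finitely many atoms in every compact subset of $(0,\infty)$), bounded from above ($M_0(b,\infty)=0$ for some finite, random $b>0$), and its set of atoms has $0$ as an accumulation point. -/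

import Mathlib

open MeasureTheory ProbabilityTheory Set Filter
open scoped NNReal ENNReal Topology

noncomputable section

/-- The critical line `c_μ(t) = -μ - t/4`. -/
def criticalLine (μ : ℝ) (t : ℝ≥0) : ℝ := -μ - (t : ℝ) / 4

/-- The path `t ↦ w(t) + α t`. -/
def driftedPath (w : ℝ≥0 → ℝ) (α : ℝ) (t : ℝ≥0) : ℝ := w t + α * (t : ℝ)

/-- The path `y`, started from `0` at time `σ` and reflected downwards at `0` (Skorokhod's formula):
`(y(t) - y(σ)) - (sup_{σ ≤ s ≤ t} (y(s) - y(σ))) ∨ 0` for `t ≥ σ`. -/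
def reflectedDown (y : ℝ≥0 → ℝ) (σ t : ℝ≥0) : ℝ :=
  (y t - y σ) - max (sSup ((fun s => y s - y σ) '' Icc σ t)) 0

/-- The drift of the `n`-th piece of the limiting diffusion: `a/4` for the pieces of type `r⁺`
(`n` even), `-(a+1)/4` for the pieces of type `r⁻` (`n` odd). -/
def pieceDrift (a : ℝ) (n : ℕ) : ℝ := if Even n then a / 4 else -(a + 1) / 4

/-- The `n`-th piece, as a function of time `t ≥ σ`, of the limiting diffusion driven by `w`,
when this piece (re)starts from `0` at time `σ`. -/
def limitPiece (a : ℝ) (w : ℝ≥0 → ℝ) (n : ℕ) (σ t : ℝ≥0) : ℝ :=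
  reflectedDown (driftedPath w (pieceDrift a n)) σ t

/-- The successive switching times of the limiting diffusion `r_μ` driven by the path `w`.
`switchTime a w μ 0 = 0` is the starting time. The `n`-th piece starts from `0` at the time
`switchTime a w μ n` and is followed until its first hitting time of the critical line, which is
`switchTime a w μ (n + 1)` (equal to `∞` if the line is never reached, and also if the `n`-th piece
never starts). -/
def switchTime (a : ℝ) (w : ℝ≥0 → ℝ) (μ : ℝ) : ℕ → ℝ≥0∞
  | 0 => 0
  | n + 1 => sInf ((fun t : ℝ≥0 => (t : ℝ≥0∞)) ''
      {t : ℝ≥0 | switchTime a w μ n ≤ (t : ℝ≥0∞) ∧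
        limitPiece a w n (switchTime a w μ n).toNNReal t ≤ criticalLine μ t})

/-- `ξ⁺(k)`: the `k`-th hitting time of the critical line by a piece of type `r⁺`. -/
def hitPlus (a : ℝ) (w : ℝ≥0 → ℝ) (μ : ℝ) (k : ℕ) : ℝ≥0∞ := switchTime a w μ (2 * k + 1)

/-- `ξ⁻(k)`: the `k`-th hitting time of the critical line by a piece of type `r⁻`. -/
def hitMinus (a : ℝ) (w : ℝ≥0 → ℝ) (μ : ℝ) (k : ℕ) : ℝ≥0∞ := switchTime a w μ (2 * k + 2)

/-- The measure `ν⁰_μ = ∑ₖ δ_{ξ⁻(k)}` on `ℝ₊`, the sum being over the `k` with `ξ⁻(k) < ∞`. -/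
def hitMeasure (a : ℝ) (w : ℝ≥0 → ℝ) (μ : ℝ) : Measure ℝ≥0 :=
  Measure.sum fun k : ℕ =>
    if hitMinus a w μ k = ∞ then 0 else Measure.dirac (hitMinus a w μ k).toNNReal

/-- `M` is a random measure on `(0,∞)` such that, for all fixed `0 < μ₁ < … < μ_k`, almost surely
`M[μᵢ,∞) = ν⁰_{μᵢ}(ℝ₊)` for every `i`. -/
def IsLimitingPointProcess {Ω : Type*} [MeasurableSpace Ω] (P : Measure Ω)
    (W : ℝ≥0 → Ω → ℝ) (a : ℝ) (M : Ω → Measure (Ioi (0 : ℝ))) : Prop :=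
  Measurable M ∧
    ∀ (k : ℕ) (μ : Fin k → Ioi (0 : ℝ)), StrictMono μ →
      ∀ᵐ ω ∂P, ∀ i, M ω (Ici (μ i)) = hitMeasure a (fun t => W t ω) (μ i) univ

/-- A discrete (point) measure on `(0,∞)`: a sum of Dirac masses with integer multiplicities, with
finitely many atoms in every compact subset of `(0,∞)`. -/
def IsDiscretePointMeasure (m : Measure (Ioi (0 : ℝ))) : Prop :=
  ∃ c : Ioi (0 : ℝ) → ℕ, (∀ K : Set (Ioi (0 : ℝ)), IsCompact K → {x ∈ K | c x ≠ 0}.Finite) ∧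
    m = Measure.sum fun x => (c x : ℝ≥0∞) • Measure.dirac x

/-- The measure `m` on `(0,∞)` is bounded from above: it gives no mass to some `(b,∞)`. -/
def IsBoundedFromAbove (m : Measure (Ioi (0 : ℝ))) : Prop :=
  ∃ b : Ioi (0 : ℝ), m (Ioi b) = 0

/-- The atoms of the measure `m` on `(0,∞)` have `0` as an accumulation point. -/
def AccumulatesAtZero (m : Measure (Ioi (0 : ℝ))) : Prop :=
  AccPt (0 : ℝ) (𝓟 ((fun x : Ioi (0 : ℝ) => (x : ℝ)) '' {x | m {x} ≠ 0}))

end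

/-! By Skorokhod's formula, the `n`-th piece started at `σ` is at or below the critical line at time
`t` iff some `s ∈ [σ, t]` has gain at least `μ`, a condition in which `μ` occurs only as a
threshold. Inductively, the `n`-th switching time is at most `T` iff there is a chain of `n` ordered
excursions before `T`, each with gain at least `μ` (`switchTime_le_iff`). This relation is
decreasing in `μ` and closed in `(μ, T)`, so for each `k` the levels `μ > 0` with `ξ⁻(k) < ∞` form
an interval `(0, x_k]`, and `M₀ = ∑ δ_{x_k}` counts correctly for all `μ` at once.

Three almost sure path properties give the rest. Sublinear growth makes every odd piece hit the
line, so `ξ⁻(k)` is finite iff `ξ⁺(k)` is, and confines the even excursions to a bounded time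
interval. There, uniform continuity allows only finitely many excursions of gain `μ`, so only
finitely many `x_k` exceed a given level (`finite_le_excursionLevel`). Oscillation near time `0`
gives `x_k > 0` for every `k`, hence accumulation at `0`. Uniqueness holds because the masses of
rational half-lines determine a measure finite away from `0`. -/

/-- The amount by which the `n`-th piece of the diffusion, reflected at time `s`, exceeds the
critical line of level `0` at time `t`. -/
noncomputable def switchGain (a : ℝ) (w : ℝ≥0 → ℝ) (n : ℕ) (s t : ℝ≥0) : ℝ :=
  w s - w t + pieceDrift a n * ((s : ℝ) - t) - (t : ℝ) / 4

/-- There are `n` successive excursions with gain at least `μ` before time `T`. -/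
def Reach (a : ℝ) (w : ℝ≥0 → ℝ) (μ : ℝ) : ℕ → ℝ≥0 → Prop
  | 0, _ => True
  | n + 1, T => ∃ s t, s ≤ t ∧ t ≤ T ∧ Reach a w μ n s ∧ μ ≤ switchGain a w n s t

/-- There are `n` successive excursions with gain greater than `μ` before time `T` and with
endpoints in `S`. -/
def StrictReach (S : Set ℝ≥0) (a : ℝ) (w : ℝ≥0 → ℝ) (μ : ℝ) : ℕ → ℝ≥0 → Prop
  | 0, _ => True
  | n + 1, T => ∃ s ∈ S, ∃ t ∈ S, s ≤ t ∧ t ≤ T ∧ StrictReach S a w μ n s ∧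
      μ < switchGain a w n s t

/-! ### Switching times as chains of excursions -/

section Deterministic

variable {a : ℝ} {w : ℝ≥0 → ℝ} {μ : ℝ}

theorem switchGain_zero_le (ha : 0 ≤ a) {s t : ℝ≥0} (hst : s ≤ t) (n : ℕ) :
    switchGain a w 0 s t ≤ switchGain a w n s t := by
  have : (s : ℝ) ≤ t := hst
  unfold switchGain pieceDrift
  split_ifs <;> simp_all
  nlinarith

theorem switchGain_le_sub (ha : 0 ≤ a) {s t : ℝ≥0} (hst : s ≤ t) (n : ℕ) :
    switchGain a w n s t ≤ w s - w t + a / 4 * ((t : ℝ) - s) := by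
  have : (s : ℝ) ≤ t := hst
  have := s.2
  unfold switchGain pieceDrift
  split_ifs
  · nlinarith [t.2]
  · nlinarith [show (0 : ℝ) ≤ s from s.2]

theorem continuous_switchGain (hw : Continuous w) (n : ℕ) :
    Continuous fun p : ℝ≥0 × ℝ≥0 => switchGain a w n p.1 p.2 := by
  unfold switchGain
  fun_prop

theorem Reach.mono_time {n : ℕ} {T T' : ℝ≥0} (h : Reach a w μ n T) (hT : T ≤ T') :
    Reach a w μ n T' := by
  cases n with
  | zero => trivial
  | succ n =>
    obtain ⟨s, t, hst, htT, h⟩ := h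
    exact ⟨s, t, hst, htT.trans hT, h⟩

theorem Reach.mono_level {n : ℕ} {T : ℝ≥0} {μ' : ℝ} (h : Reach a w μ n T) (hμ : μ' ≤ μ) :
    Reach a w μ' n T := by
  induction n generalizing T with
  | zero => trivial
  | succ n ih =>
    obtain ⟨s, t, hst, htT, h, hg⟩ := h
    exact ⟨s, t, hst, htT, ih h, hμ.trans hg⟩

theorem Reach.of_succ {n : ℕ} {T : ℝ≥0} (h : Reach a w μ (n + 1) T) : Reach a w μ n T := by
  obtain ⟨s, t, hst, htT, h, -⟩ := h
  exact h.mono_time (hst.trans htT)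

theorem Reach.anti {m n : ℕ} {T : ℝ≥0} (h : Reach a w μ n T) (hmn : m ≤ n) :
    Reach a w μ m T := by
  induction hmn with
  | refl => exact h
  | step _ ih => exact ih h.of_succ

theorem StrictReach.reach {S : Set ℝ≥0} {n : ℕ} {T : ℝ≥0} (h : StrictReach S a w μ n T) :
    Reach a w μ n T := by
  induction n generalizing T with
  | zero => trivial
  | succ n ih =>
    obtain ⟨s, -, t, -, hst, htT, h, hg⟩ := h
    exact ⟨s, t, hst, htT, ih h, hg.le⟩

theorem StrictReach.congr {S : Set ℝ≥0} {w' : ℝ≥0 → ℝ} (hw : ∀ s ∈ S, w s = w' s) {n : ℕ}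
    {T : ℝ≥0} (h : StrictReach S a w μ n T) : StrictReach S a w' μ n T := by
  induction n generalizing T with
  | zero => trivial
  | succ n ih =>
    obtain ⟨s, hs, t, ht, hst, htT, h, hg⟩ := h
    refine ⟨s, hs, t, ht, hst, htT, ih h, ?_⟩
    rwa [switchGain, ← hw s hs, ← hw t ht]

/-- Each endpoint can be moved slightly to the right into `S` at the cost of an arbitrarily small
loss of gain. Moving `s` to `s' > s` creates the room that the earlier excursions need. -/
theorem Reach.strictReach {S : Set ℝ≥0} (hS : Dense S) (hw : Continuous w) {μ' : ℝ}
    (hμ : μ' < μ) {n : ℕ} {T T' : ℝ≥0} (h : Reach a w μ n T) (hT : T < T') :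
    StrictReach S a w μ' n T' := by
  induction n generalizing T T' with
  | zero => trivial
  | succ n ih =>
    obtain ⟨s, t, hst, htT, h, hg⟩ := h
    have hU : {p : ℝ≥0 × ℝ≥0 | μ' < switchGain a w n p.1 p.2} ∈ 𝓝 (s, t) :=
      (isOpen_lt continuous_const (continuous_switchGain hw n)).mem_nhds (hμ.trans_le hg)
    obtain ⟨U, V, hUo, hsU, hVo, htV, hUV⟩ := mem_nhds_prod_iff'.1 hU
    obtain ⟨s₁, hs₁, hs₁U⟩ := exists_Ico_subset_of_mem_nhds (hUo.mem_nhds hsU)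
      ⟨T', (hst.trans htT).trans_lt hT⟩
    obtain ⟨t₁, ht₁, ht₁V⟩ := exists_Ico_subset_of_mem_nhds (hVo.mem_nhds htV)
      ⟨T', htT.trans_lt hT⟩
    obtain ⟨t', ht'S, htt', ht't₁⟩ := hS.exists_between (show t < min t₁ T' from
      lt_min ht₁ (htT.trans_lt hT))
    obtain ⟨s', hs'S, hss', hs's₁⟩ := hS.exists_between (show s < min s₁ t' from
      lt_min hs₁ (hst.trans_lt htt'))
    rw [lt_min_iff] at hs's₁ ht't₁
    exact ⟨s', hs'S, t', ht'S, hs's₁.2.le, ht't₁.2.le, ih h hss',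
      hUV (mk_mem_prod (hs₁U ⟨hss'.le, hs's₁.1⟩) (ht₁V ⟨htt'.le, ht't₁.1⟩))⟩

theorem isClosed_reach (hw : Continuous w) (n : ℕ) :
    IsClosed {p : ℝ × ℝ≥0 | Reach a w p.1 n p.2} := by
  induction n with
  | zero => simp [Reach]
  | succ n ih =>
    -- Writing `t = T * v` and `s = T * v * u` with `u, v ∈ [0, 1]` turns the existential into a
    -- projection along a fixed compact factor, which is a closed map.
    let I := Icc (0 : ℝ≥0) 1
    let C : Set ((ℝ × ℝ≥0) × (I × I)) :=
      {q | Reach a w q.1.1 n (q.1.2 * q.2.1 * q.2.2) ∧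
        q.1.1 ≤ switchGain a w n (q.1.2 * q.2.1 * q.2.2) (q.1.2 * q.2.1)}
    have hC : IsClosed C := by
      refine IsClosed.inter (ih.preimage (f := fun q : (ℝ × ℝ≥0) × (I × I) =>
        (q.1.1, q.1.2 * (q.2.1 : ℝ≥0) * (q.2.2 : ℝ≥0))) (by fun_prop)) ?_
      exact isClosed_le (by fun_prop) ((continuous_switchGain hw n).comp
        (f := fun q : (ℝ × ℝ≥0) × (I × I) =>
          (q.1.2 * (q.2.1 : ℝ≥0) * (q.2.2 : ℝ≥0), q.1.2 * (q.2.1 : ℝ≥0))) (by fun_prop))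
    have key : ∀ x y : ℝ≥0, x ≤ y → ∃ u : I, y * u = x := fun x y hxy => by
      refine ⟨⟨x / y, zero_le, div_le_one_of_le₀ hxy zero_le⟩, ?_⟩
      rcases eq_or_ne y 0 with rfl | hy
      · simp [nonpos_iff_eq_zero.1 hxy]
      · exact mul_div_cancel₀ x hy
    convert isClosedMap_fst_of_compactSpace C hC using 1
    ext ⟨ν, T⟩
    constructor
    · rintro ⟨s, t, hst, htT, h, hg⟩
      obtain ⟨v, rfl⟩ := key t T htT
      obtain ⟨u, rfl⟩ := key s _ hst
      exact ⟨((ν, T), (v, u)), ⟨h, hg⟩, rfl⟩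
    · rintro ⟨⟨⟨ν', T'⟩, v, u⟩, ⟨h, hg⟩, he⟩
      obtain ⟨rfl, rfl⟩ := Prod.mk.inj he
      exact ⟨_, _, mul_le_of_le_one_right' u.2.2, mul_le_of_le_one_right' v.2.2, h, hg⟩

/-- The supremum in Skorokhod's formula is attained by continuity, and the normalisation at `σ`
cancels in the difference. -/
theorem limitPiece_le_criticalLine_iff (hw : Continuous w) (n : ℕ) {σ t : ℝ≥0} (hσt : σ ≤ t) :
    limitPiece a w n σ t ≤ criticalLine μ t ↔ ∃ s ∈ Icc σ t, μ ≤ switchGain a w n s t := by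
  set f : ℝ≥0 → ℝ := fun s =>
    driftedPath w (pieceDrift a n) s - driftedPath w (pieceDrift a n) σ with hf
  have hfc : Continuous f := by unfold f driftedPath; fun_prop
  have hne : (Icc σ t).Nonempty := nonempty_Icc.2 hσt
  have hbdd : BddAbove (f '' Icc σ t) := (isCompact_Icc.image hfc).bddAbove
  have h0 : 0 ≤ sSup (f '' Icc σ t) := by
    have : f σ ≤ sSup (f '' Icc σ t) := le_csSup hbdd ⟨σ, left_mem_Icc.2 hσt, rfl⟩
    simpa [hf] using this
  have hlim : limitPiece a w n σ t = f t - sSup (f '' Icc σ t) := by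
    rw [limitPiece, reflectedDown, max_eq_left h0]
  have hgain : ∀ s, switchGain a w n s t = f s - f t - (t : ℝ) / 4 := fun s => by
    simp only [switchGain, hf, driftedPath]; ring
  rw [hlim, criticalLine]
  constructor
  · intro h
    obtain ⟨s, hs, hsup, -⟩ := isCompact_Icc.exists_sSup_image_eq_and_ge hne hfc.continuousOn
    exact ⟨s, hs, by rw [hgain, ← hsup]; linarith⟩
  · rintro ⟨s, hs, h⟩
    have : f s ≤ sSup (f '' Icc σ t) := le_csSup hbdd ⟨s, hs, rfl⟩
    rw [hgain] at h
    linarith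

theorem switchTime_le_iff (hw : Continuous w) (n : ℕ) (T : ℝ≥0) :
    switchTime a w μ n ≤ T ↔ Reach a w μ n T := by
  induction n generalizing T with
  | zero => simp [switchTime, Reach]
  | succ n ih =>
    have hD : {t : ℝ≥0 | switchTime a w μ n ≤ (t : ℝ≥0∞) ∧
        limitPiece a w n (switchTime a w μ n).toNNReal t ≤ criticalLine μ t} =
        {t | ∃ s ≤ t, Reach a w μ n s ∧ μ ≤ switchGain a w n s t} := by
      ext t
      simp only [Set.mem_ofPred_eq]
      constructor
      · rintro ⟨h₁, h₂⟩
        have hfin : switchTime a w μ n ≠ ∞ := ne_top_of_le_ne_top ENNReal.coe_ne_top h₁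
        rw [← ENNReal.coe_toNNReal hfin, ENNReal.coe_le_coe] at h₁
        obtain ⟨s, hs, hg⟩ := (limitPiece_le_criticalLine_iff hw n h₁).1 h₂
        refine ⟨s, hs.2, (ih s).1 ?_, hg⟩
        rw [← ENNReal.coe_toNNReal hfin]
        exact_mod_cast hs.1
      · rintro ⟨s, hst, hs, hg⟩
        have h₁ := (ih s).2 hs
        have hfin : switchTime a w μ n ≠ ∞ := ne_top_of_le_ne_top ENNReal.coe_ne_top h₁
        refine ⟨h₁.trans (by exact_mod_cast hst), ?_⟩
        rw [← ENNReal.coe_toNNReal hfin, ENNReal.coe_le_coe] at h₁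
        exact (limitPiece_le_criticalLine_iff hw n (h₁.trans hst)).2 ⟨s, ⟨h₁, hst⟩, hg⟩
    rw [switchTime, hD]
    constructor
    · intro h
      -- An infimum at most `T` only yields hits before each `T' > T`; closedness brings this down
      -- to `T` itself.
      have hcl : IsClosed {t : ℝ≥0 | Reach a w μ (n + 1) t} :=
        (isClosed_reach hw (n + 1)).preimage (f := fun t : ℝ≥0 => (μ, t)) (by fun_prop)
      have hmem : ∀ T' > T, Reach a w μ (n + 1) T' := fun T' hT' => by
        obtain ⟨_, ⟨t, ⟨s, hst, hs, hg⟩, rfl⟩, ht⟩ :=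
          sInf_lt_iff.1 (h.trans_lt (ENNReal.coe_lt_coe.2 hT'))
        exact ⟨s, t, hst, (ENNReal.coe_lt_coe.1 ht).le, hs, hg⟩
      have : T ∈ closure (Ioi T) := by rw [closure_Ioi]; exact self_mem_Ici
      exact closure_minimal (fun T' hT' => hmem T' hT') hcl this
    · rintro ⟨s, t, hst, htT, hs, hg⟩
      have ht : t ∈ {t | ∃ s ≤ t, Reach a w μ n s ∧ μ ≤ switchGain a w n s t} := ⟨s, hst, hs, hg⟩
      exact (sInf_le (mem_image_of_mem _ ht)).trans (ENNReal.coe_le_coe.2 htT)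

theorem switchTime_ne_top_iff (hw : Continuous w) (n : ℕ) :
    switchTime a w μ n ≠ ∞ ↔ ∃ T, Reach a w μ n T := by
  constructor
  · intro h
    exact ⟨_, (switchTime_le_iff hw n _).1 (ENNReal.coe_toNNReal h).ge⟩
  · rintro ⟨T, h⟩
    exact ne_top_of_le_ne_top ENNReal.coe_ne_top ((switchTime_le_iff hw n T).2 h)

end Deterministic

/-! ### Consequences of path regularity -/

/-- The almost sure properties of the driving path. -/
structure IsRegularPath (a : ℝ) (w : ℝ≥0 → ℝ) : Prop where
  continuous : Continuous w
  sublinear : ∀ ε > 0, ∃ T : ℝ≥0, ∀ t ≥ T, |w t| ≤ ε * t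
  oscillates : ∀ T > 0, ∃ s t : ℝ≥0, 0 < s ∧ s ≤ t ∧ t ≤ T ∧ 0 < switchGain a w 0 s t

open Classical in
/-- The supremum of the levels for which `2 k + 1` excursions occur. -/
noncomputable def excursionLevel (S : Set ℝ≥0) (a : ℝ) (w : ℝ≥0 → ℝ) (k : ℕ) : ℝ :=
  ⨆ q : ℚ, if 0 < q ∧ ∃ T ∈ S, StrictReach S a w q (2 * k + 1) T then (q : ℝ) else 0

namespace IsRegularPath

variable {a : ℝ} {w : ℝ≥0 → ℝ}

theorem exists_bound (hw : IsRegularPath a w) (ha : 0 < a) :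
    ∃ T₀ : ℝ≥0, ∀ n s t, Even n → s ≤ t → 0 < switchGain a w n s t → t ≤ T₀ := by
  -- With this constant `w s - w t ≤ B + t / 8`, which the term `-t / 4` of the gain outweighs once
  -- `t > 8 * B`.
  obtain ⟨T₁, hT₁⟩ := hw.sublinear (1 / 16) (by norm_num)
  obtain ⟨B, hB⟩ := (isCompact_Icc (a := (0 : ℝ≥0)) (b := T₁)).exists_bound_of_continuousOn
    hw.continuous.continuousOn
  have hB0 : 0 ≤ B := (norm_nonneg _).trans (hB 0 ⟨le_rfl, zero_le⟩)
  refine ⟨max T₁ (8 * B.toNNReal), fun n s t hn hst hg => ?_⟩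
  by_contra! h
  obtain ⟨h1, h2⟩ := max_lt_iff.1 h
  have h2' : 8 * B < t := by
    have : ((8 * B.toNNReal : ℝ≥0) : ℝ) < t := h2
    rwa [NNReal.coe_mul, Real.coe_toNNReal _ hB0] at this
  have hst' : (s : ℝ) ≤ t := hst
  have ht := (abs_le.1 (hT₁ t h1.le)).1
  have hs : w s ≤ B + 1 / 16 * t := by
    rcases le_total s T₁ with h | h
    · have := (abs_le.1 (hB s ⟨zero_le, h⟩)).2
      linarith [t.2, show (0 : ℝ) ≤ t from t.2]
    · have := (abs_le.1 (hT₁ s h)).2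
      linarith
  rw [switchGain, pieceDrift, if_pos hn] at hg
  nlinarith

/-- For odd pieces the gain is `w s - w t - (a + 1) / 4 * s + a / 4 * t`, which tends to infinity
with `t`. -/
theorem exists_odd_gain (hw : IsRegularPath a w) (ha : 0 < a) {n : ℕ} (hn : ¬ Even n) (s : ℝ≥0)
    (μ : ℝ) : ∃ t ≥ s, μ ≤ switchGain a w n s t := by
  obtain ⟨T₁, hT₁⟩ := hw.sublinear (a / 8) (by positivity)
  let c : ℝ := 8 / a * (μ - w s + (a + 1) / 4 * s)
  refine ⟨max (max T₁ s) c.toNNReal, (le_max_right _ _).trans (le_max_left _ _), ?_⟩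
  set t := max (max T₁ s) c.toNNReal with ht
  have h1 := (abs_le.1 (hT₁ t ((le_max_left _ _).trans (le_max_left _ _)))).2
  have h2 : c ≤ t := (Real.le_coe_toNNReal c).trans (NNReal.coe_le_coe.2 (le_max_right _ _))
  have h3 : a / 8 * c = μ - w s + (a + 1) / 4 * s := by
    simp only [c]; field_simp
  have h4 : a / 8 * c ≤ a / 8 * t := by gcongr
  rw [switchGain, pieceDrift, if_neg hn]
  linarith

theorem exists_reach_even (hw : IsRegularPath a w) (ha : 0 < a) {μ : ℝ} {k : ℕ} {T : ℝ≥0}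
    (h : Reach a w μ (2 * k + 1) T) : ∃ T', Reach a w μ (2 * k + 2) T' := by
  obtain ⟨t, htT, hg⟩ := hw.exists_odd_gain ha (n := 2 * k + 1) (by simp) T μ
  exact ⟨t, T, t, htT, le_rfl, h, hg⟩

/-- The last of the `2 * k + 1` excursions has even index, so it ends before a time depending only
on the path. -/
theorem exists_reach_bound (hw : IsRegularPath a w) (ha : 0 < a) :
    ∃ T₀ : ℝ≥0, ∀ (μ : ℝ) (k : ℕ) (T : ℝ≥0), 0 < μ → Reach a w μ (2 * k + 1) T →
      Reach a w μ (2 * k + 1) T₀ := by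
  obtain ⟨T₀, hT₀⟩ := hw.exists_bound ha
  refine ⟨T₀, fun μ k T hμ ⟨s, t, hst, htT, h, hg⟩ => ⟨s, t, hst, ?_, h, hg⟩⟩
  exact hT₀ _ s t (by simp) hst (hμ.trans_le hg)

/-- A gain of at least `μ` forces an oscillation of `a / 4 * t - w t` by `μ`, so each excursion
lasts at least `δ`, the modulus of uniform continuity on `[0, T₀]`. -/
theorem exists_not_reach (hw : IsRegularPath a w) (ha : 0 < a) {μ : ℝ} (hμ : 0 < μ) (T₀ : ℝ≥0) :
    ∃ N, ∀ n ≥ N, ¬ Reach a w μ n T₀ := by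
  let f : ℝ≥0 → ℝ := fun t => a / 4 * t - w t
  have hf : Continuous f := by have := hw.continuous; unfold f; fun_prop
  obtain ⟨δ, hδ, hδf⟩ := Metric.uniformContinuousOn_iff.1
    ((isCompact_Icc (a := (0 : ℝ≥0)) (b := T₀)).uniformContinuousOn_of_continuous
      hf.continuousOn) μ hμ
  have key : ∀ n T, T ≤ T₀ → Reach a w μ n T → n * δ ≤ T := by
    intro n
    induction n with
    | zero => intro T _ _; simp
    | succ n ih =>
      rintro T hT ⟨s, t, hst, htT, h, hg⟩
      have hs := ih s ((hst.trans htT).trans hT) h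
      have hst' : (s : ℝ) ≤ t := hst
      have htT' : (t : ℝ) ≤ T := htT
      have hgap : δ ≤ t - s := by
        by_contra! hlt
        have hd : dist t s < δ := by
          rwa [NNReal.dist_eq, abs_of_nonneg (by linarith)]
        have := hδf t ⟨zero_le, htT.trans hT⟩ s ⟨zero_le, (hst.trans htT).trans hT⟩ hd
        have h1 := (abs_lt.1 (Real.dist_eq (f t) (f s) ▸ this)).2
        have h2 := switchGain_le_sub (w := w) ha.le hst n
        simp only [f] at h1
        linarith
      push_cast
      linarith
  obtain ⟨N, hN⟩ := exists_nat_gt ((T₀ : ℝ) / δ)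
  refine ⟨N, fun n hn h => ?_⟩
  have h1 := key n T₀ le_rfl h
  have h2 : (T₀ : ℝ) < N * δ := (div_lt_iff₀ hδ).1 hN
  have h3 : (N : ℝ) * δ ≤ n * δ := by gcongr
  linarith

theorem exists_pos_reach (hw : IsRegularPath a w) (ha : 0 < a) (n : ℕ) {T : ℝ≥0} (hT : 0 < T) :
    ∃ μ > 0, Reach a w μ n T := by
  induction n generalizing T with
  | zero => exact ⟨1, one_pos, trivial⟩
  | succ n ih =>
    -- The last excursion is chosen first; since `s > 0`, the earlier ones fit into `[0, s]`.
    obtain ⟨s, t, hs, hst, htT, hg⟩ := hw.oscillates T hT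
    obtain ⟨μ, hμ, h⟩ := ih hs
    exact ⟨min μ (switchGain a w 0 s t), lt_min hμ hg, s, t, hst, htT,
      h.mono_level (min_le_left _ _), (min_le_right _ _).trans (switchGain_zero_le ha.le hst n)⟩

theorem exists_level_bound (hw : IsRegularPath a w) (ha : 0 < a) :
    ∃ b : ℝ, ∀ (μ : ℝ) (k : ℕ) (T : ℝ≥0), 0 < μ → Reach a w μ (2 * k + 1) T → μ ≤ b := by
  obtain ⟨T₀, hT₀⟩ := hw.exists_bound ha
  obtain ⟨B, hB⟩ := (isCompact_Icc (a := (0 : ℝ≥0)) (b := T₀)).exists_bound_of_continuousOn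
    hw.continuous.continuousOn
  refine ⟨B + B + a / 4 * T₀, fun μ k T hμ ⟨s, t, hst, htT, h, hg⟩ => ?_⟩
  have ht : t ≤ T₀ := hT₀ _ s t (by simp) hst (hμ.trans_le hg)
  have h1 := (abs_le.1 (hB s ⟨zero_le, hst.trans ht⟩)).2
  have h2 := (abs_le.1 (hB t ⟨zero_le, ht⟩)).1
  have h3 := switchGain_le_sub (w := w) ha.le hst (2 * k)
  have h4 : a / 4 * ((t : ℝ) - s) ≤ a / 4 * T₀ := by
    have : (t : ℝ) ≤ T₀ := ht
    have : (0 : ℝ) ≤ s := s.2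
    gcongr
    linarith
  linarith

/-! ### The excursion levels -/

section Level

variable {S : Set ℝ≥0} {k : ℕ}

theorem bddAbove_level (hw : IsRegularPath a w) (ha : 0 < a) (S : Set ℝ≥0) (k : ℕ) :
    BddAbove (range fun q : ℚ => open Classical in
      if 0 < q ∧ ∃ T ∈ S, StrictReach S a w q (2 * k + 1) T then (q : ℝ) else 0) := by
  obtain ⟨b, hb⟩ := hw.exists_level_bound ha
  refine ⟨max b 0, ?_⟩
  rintro _ ⟨q, rfl⟩
  dsimp only
  split_ifs with h
  · obtain ⟨hq, T, -, hT⟩ := h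
    exact le_max_of_le_left (hb q k T (by exact_mod_cast hq) hT.reach)
  · exact le_max_right _ _

/-- The supremum is attained: all levels below it are reached before one common time `T₀`, and at
fixed `T₀` the set of reached levels is closed. -/
theorem le_excursionLevel_iff (hw : IsRegularPath a w) (ha : 0 < a) (hS : Dense S) {μ : ℝ}
    (hμ : 0 < μ) : μ ≤ excursionLevel S a w k ↔ ∃ T, Reach a w μ (2 * k + 1) T := by
  classical
  constructor
  · intro h
    obtain ⟨T₀, hT₀⟩ := hw.exists_reach_bound ha
    refine ⟨T₀, ?_⟩
    have hcl : IsClosed {ν : ℝ | Reach a w ν (2 * k + 1) T₀} :=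
      (isClosed_reach hw.continuous (2 * k + 1)).preimage (f := fun ν : ℝ => (ν, T₀)) (by fun_prop)
    have hmem : Ioo 0 μ ⊆ {ν : ℝ | Reach a w ν (2 * k + 1) T₀} := by
      rintro ν ⟨hν, hνμ⟩
      obtain ⟨q, hq⟩ := exists_lt_of_lt_ciSup (hνμ.trans_le h)
      split_ifs at hq with hc
      · obtain ⟨-, T, -, hT⟩ := hc
        exact hT₀ ν k T hν (hT.reach.mono_level hq.le)
      · exact absurd hq hν.not_gt
    have : μ ∈ closure (Ioo 0 μ) := by
      rw [closure_Ioo hμ.ne]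
      exact ⟨hμ.le, le_rfl⟩
    exact closure_minimal hmem hcl this
  · rintro ⟨T, hT⟩
    refine le_of_forall_lt fun ν hν => ?_
    obtain ⟨q, hq, hqμ⟩ := exists_rat_btwn (max_lt hν hμ)
    rw [max_lt_iff] at hq
    obtain ⟨T', hT'S, hT'⟩ := hS.exists_gt T
    refine hq.1.trans_le ?_
    refine le_trans (le_of_eq (if_pos ⟨by exact_mod_cast hq.2, T', hT'S,
      hT.strictReach hS hw.continuous hqμ hT'⟩).symm) (le_ciSup (hw.bddAbove_level ha S k) q)

theorem excursionLevel_pos (hw : IsRegularPath a w) (ha : 0 < a) (hS : Dense S) (k : ℕ) :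
    0 < excursionLevel S a w k := by
  obtain ⟨μ, hμ, h⟩ := hw.exists_pos_reach ha (2 * k + 1) one_pos
  exact hμ.trans_le ((hw.le_excursionLevel_iff ha hS hμ).2 ⟨1, h⟩)

theorem le_excursionLevel_iff_hitMinus (hw : IsRegularPath a w) (ha : 0 < a) (hS : Dense S)
    {μ : ℝ} (hμ : 0 < μ) : μ ≤ excursionLevel S a w k ↔ hitMinus a w μ k ≠ ∞ := by
  rw [hw.le_excursionLevel_iff ha hS hμ, hitMinus, switchTime_ne_top_iff hw.continuous]
  exact ⟨fun ⟨_, h⟩ => hw.exists_reach_even ha h, fun ⟨T, h⟩ => ⟨T, h.of_succ⟩⟩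

theorem excursionLevel_le_zero (hw : IsRegularPath a w) (ha : 0 < a) (hS : Dense S) (k : ℕ) :
    excursionLevel S a w k ≤ excursionLevel S a w 0 := by
  have hpos := hw.excursionLevel_pos ha hS k
  obtain ⟨T, hT⟩ := (hw.le_excursionLevel_iff ha hS hpos).1 le_rfl
  exact (hw.le_excursionLevel_iff ha hS hpos).2 ⟨T, hT.anti (by lia)⟩

theorem finite_le_excursionLevel (hw : IsRegularPath a w) (ha : 0 < a) (hS : Dense S) {μ : ℝ}
    (hμ : 0 < μ) : {k | μ ≤ excursionLevel S a w k}.Finite := by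
  obtain ⟨T₀, hT₀⟩ := hw.exists_reach_bound ha
  obtain ⟨N, hN⟩ := hw.exists_not_reach ha hμ T₀
  refine (finite_lt_nat N).subset fun k hk => ?_
  obtain ⟨T, hT⟩ := (hw.le_excursionLevel_iff ha hS hμ).1 hk
  by_contra h
  exact hN (2 * k + 1) (by simp at h; lia) (hT₀ μ k T hμ hT)

end Level

end IsRegularPath

/-! ### Almost sure regularity of Brownian paths -/

section Brownian

variable {Ω : Type*} [MeasurableSpace Ω] {P : Measure Ω} {B W : ℝ≥0 → Ω → ℝ}

theorem IsPreBrownianReal.map_restrict_eq (hB : IsPreBrownianReal B P)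
    (hW : IsPreBrownianReal W P) (S : Set ℝ≥0) [Countable S] :
    P.map (fun ω (t : S) => B t ω) = P.map (fun ω (t : S) => W t ω) := by
  have := hB.isGaussianProcess.isProbabilityMeasure
  rw [map_eq_iff_forall_finset_map_restrict_eq
    (X := fun (t : S) ω => B t ω) (Y := fun (t : S) ω => W t ω)
    (aemeasurable_pi_lambda _ fun t => hB.aemeasurable t)
    (aemeasurable_pi_lambda _ fun t => hW.aemeasurable t)]
  intro I
  classical
  let J : Finset ℝ≥0 := I.image (fun t : S => (t : ℝ≥0))
  let φ : (J → ℝ) → (I → ℝ) := fun x i => x ⟨i, Finset.mem_image_of_mem _ i.2⟩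
  have hφ : Measurable φ := by fun_prop
  have key : ∀ {X : ℝ≥0 → Ω → ℝ}, IsPreBrownianReal X P →
      P.map (fun ω => I.restrict fun t : S => X t ω) =
        (BrownianReal.projectiveFamily J).map φ := fun {X} hX => by
    rw [← (hX.hasLaw J).map_eq, AEMeasurable.map_map_of_aemeasurable hφ.aemeasurable
      (hX.hasLaw J).aemeasurable]
    rfl
  exact (key hB).trans (key hW).symm

/-- Time inversion: `t * W (1 / t)` has the law of `W` on a countable dense set, so the decay of `W`
at `0`, encoded by the measurable event `A`, passes to it. Continuity away from `0` then covers all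
times. -/
theorem IsBrownianReal.ae_sublinear (hW : IsBrownianReal W P) :
    ∀ᵐ ω ∂P, ∀ ε > 0, ∃ T : ℝ≥0, ∀ t ≥ T, |W t ω| ≤ ε * t := by
  obtain ⟨S, hSc, hSd⟩ := TopologicalSpace.exists_countable_dense ℝ≥0
  have : Countable S := hSc.to_subtype
  let A : Set (S → ℝ) := {x | ∀ k : ℕ, ∃ j : ℕ, ∀ t : S, (t : ℝ≥0) < 1 / (j + 1) →
    |x t| ≤ 1 / (k + 1)}
  have hA : MeasurableSet A := by
    have : A = ⋂ k : ℕ, ⋃ j : ℕ, ⋂ t : S, ⋂ _ : (t : ℝ≥0) < 1 / (j + 1),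
        {x : S → ℝ | |x t| ≤ 1 / (k + 1)} := by
      ext; simp [A]
    rw [this]
    refine .iInter fun k => .iUnion fun j => .iInter fun t => .iInter fun _ => ?_
    exact measurableSet_le (by fun_prop) measurable_const
  have hinv := hW.toIsPreBrownianReal.inv
  have h1 : ∀ᵐ ω ∂P, (fun t : S => W t ω) ∈ A := by
    filter_upwards [hW.tendsto_nhds_zero] with ω hω k
    obtain ⟨δ, hδ, h⟩ := Metric.tendsto_nhds_nhds.1 hω (1 / (k + 1)) (by positivity)
    obtain ⟨j, hj⟩ := exists_nat_one_div_lt hδ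
    refine ⟨j, fun t ht => ?_⟩
    have ht' : ((t : ℝ≥0) : ℝ) < 1 / (j + 1) := by exact_mod_cast ht
    have := h (x := (t : ℝ≥0)) (by
      rw [NNReal.dist_eq, NNReal.coe_zero, sub_zero, abs_of_nonneg (NNReal.coe_nonneg _)]
      exact ht'.trans hj)
    rw [dist_zero_right] at this
    exact this.le
  have h2 : ∀ᵐ ω ∂P, (fun t : S => (t : ℝ) * W (1 / t) ω) ∈ A := by
    rw [← ae_map_iff (p := (· ∈ A)) (aemeasurable_pi_lambda _ fun t : S => hinv.aemeasurable t) hA,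
      IsPreBrownianReal.map_restrict_eq hinv hW.toIsPreBrownianReal S,
      ae_map_iff (p := (· ∈ A)) (aemeasurable_pi_lambda _ fun t : S => hW.aemeasurable t) hA]
    exact h1
  filter_upwards [h2, hW.cont] with ω h2 hc ε hε
  obtain ⟨k, hk⟩ := exists_nat_one_div_lt hε
  obtain ⟨j, hj⟩ := h2 k
  refine ⟨j + 2, fun t ht => ?_⟩
  have ht0 : 0 < t := lt_of_lt_of_le (by positivity) ht
  have hcl : Ioo 0 ((1 : ℝ≥0) / (j + 1)) ⊆
      closure (Ioo 0 ((1 : ℝ≥0) / (j + 1)) ∩ S) :=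
    hSd.open_subset_closure_inter isOpen_Ioo
  have hmem : t⁻¹ ∈ Ioo 0 ((1 : ℝ≥0) / (j + 1)) := by
    refine ⟨by positivity, ?_⟩
    rw [one_div]
    refine inv_strictAnti₀ (by positivity) (lt_of_lt_of_le ?_ ht)
    gcongr; norm_num
  have hcont : ContinuousAt (fun u : ℝ≥0 => |(u : ℝ) * W (1 / u) ω|) t⁻¹ := by
    have h0 : t⁻¹ ≠ 0 := by positivity
    have : ContinuousAt (fun u : ℝ≥0 => W (1 / u) ω) t⁻¹ :=
      hc.continuousAt.comp (f := fun u : ℝ≥0 => 1 / u)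
        (continuousAt_const.div continuousAt_id h0)
    exact (NNReal.continuous_coe.continuousAt.mul this).abs
  have hle : |((t⁻¹ : ℝ≥0) : ℝ) * W (1 / t⁻¹) ω| ≤ 1 / (k + 1) := by
    have hcw := mem_closure_iff_frequently.1 (hcl hmem)
    exact isClosed_Iic.mem_of_frequently_of_tendsto
      (hcw.mono fun u hu => hj ⟨u, hu.2⟩ hu.1.2) hcont
  have htr : (0 : ℝ) < t := ht0
  rw [one_div, inv_inv, abs_mul, NNReal.coe_inv, abs_of_nonneg (by positivity),
    inv_mul_le_iff₀ htr] at hle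
  calc |W t ω| ≤ t * (1 / (k + 1)) := hle
    _ ≤ t * ε := by gcongr
    _ = ε * t := mul_comm _ _

theorem gaussianReal_Ioi_pos {v : ℝ≥0} (hv : v ≠ 0) (m c : ℝ) : 0 < gaussianReal m v (Ioi c) := by
  rw [pos_iff_ne_zero]
  intro h
  have := gaussianReal_absolutelyContinuous' m hv h
  simp at this

theorem IsPreBrownianReal.iIndepFun_geometric_increments (hB : IsPreBrownianReal B P) :
    iIndepFun (fun (n : ℕ) ω => B (2⁻¹ ^ (n + 1)) ω - B (2⁻¹ ^ n) ω) P := by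
  have := hB.isGaussianProcess.isProbabilityMeasure
  have hG : IsGaussianProcess (fun (p : (_ : ℕ) × Unit) ω =>
      B (2⁻¹ ^ (p.1 + 1)) ω - B (2⁻¹ ^ p.1) ω) P := by
    apply hB.isGaussianProcess.of_isGaussianProcess
    rintro ⟨n, -⟩
    exact ⟨{2⁻¹ ^ (n + 1), 2⁻¹ ^ n},
      { toFun x := x ⟨2⁻¹ ^ (n + 1), by simp⟩ - x ⟨2⁻¹ ^ n, by simp⟩
        map_add' x y := by simp; abel
        map_smul' c x := by simp; ring }, by simp⟩
  have h := hG.iIndepFun_of_covariance_eq_zero (S := fun _ : ℕ => Unit)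
    (X := fun n _ ω => B (2⁻¹ ^ (n + 1)) ω - B (2⁻¹ ^ n) ω)
    (fun n _ => (hB.aemeasurable _).sub (hB.aemeasurable _)) ?_
  · exact h.comp (fun _ x => x ()) fun _ => measurable_pi_apply ()
  · intro m n hmn _ _
    have hmem : ∀ t, MemLp (B t) 2 P := fun t =>
      (hB.isGaussianProcess.hasGaussianLaw_eval t).memLp_two
    rw [covariance_fun_sub_fun_sub (hmem _) (hmem _) (hmem _) (hmem _)]
    simp_rw [hB.covariance_fun_eval]
    have hanti : ∀ i j : ℕ, i ≤ j → (2⁻¹ : ℝ≥0) ^ j ≤ 2⁻¹ ^ i := fun i j hij =>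
      pow_le_pow_of_le_one zero_le (by norm_num) hij
    rcases hmn.lt_or_gt with h | h
    · rw [min_eq_right (hanti _ _ (by lia)), min_eq_right (hanti _ _ (by lia)),
        min_eq_right (hanti _ _ (by lia)), min_eq_right (hanti _ _ (by lia))]
      ring
    · rw [min_eq_left (hanti _ _ (by lia)), min_eq_left (hanti _ _ (by lia)),
        min_eq_left (hanti _ _ (by lia)), min_eq_left (hanti _ _ (by lia))]
      ring

/-- The increment has variance `v = 2⁻¹ ^ (n + 1) ≤ 1`, and the threshold is `2 * c * v ≤ 2 * c *
√v`. The bound is uniform in `n`, as the second Borel–Cantelli lemma requires. -/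
theorem IsPreBrownianReal.le_measure_geometric_increment (hB : IsPreBrownianReal B P) {c : ℝ}
    (hc : 0 ≤ c) (n : ℕ) :
    gaussianReal 0 1 (Ioi (2 * c)) ≤
      P {ω | c * 2⁻¹ ^ n < B (2⁻¹ ^ (n + 1)) ω - B (2⁻¹ ^ n) ω} := by
  have hlaw := hB.hasLaw_sub (2⁻¹ ^ (n + 1)) (2⁻¹ ^ n)
  set v : ℝ≥0 := 2⁻¹ ^ (n + 1) with hv
  have hv0 : 0 < v := by positivity
  have hdist : nndist (v : ℝ) (((2⁻¹ : ℝ≥0) ^ n : ℝ≥0) : ℝ) = v := by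
    ext
    rw [coe_nndist, Real.dist_eq, hv, pow_succ]
    push_cast
    rw [abs_of_nonpos (by nlinarith [show (0 : ℝ) < 2⁻¹ ^ n by positivity])]
    ring
  have hset : {ω | c * 2⁻¹ ^ n < B v ω - B (2⁻¹ ^ n) ω} =
      (B v - B (2⁻¹ ^ n)) ⁻¹' Ioi (c * 2⁻¹ ^ n) := rfl
  have hmap : gaussianReal 0 v = (gaussianReal 0 1).map (√(v : ℝ) * ·) := by
    rw [gaussianReal_map_const_mul]
    congr 1
    · simp
    · simp
  have hle : gaussianReal 0 1 (Ioi (2 * c)) ≤ gaussianReal 0 v (Ioi (c * 2⁻¹ ^ n)) := by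
    rw [hmap, Measure.map_apply (by fun_prop) measurableSet_Ioi]
    refine measure_mono fun x (hx : 2 * c < x) => ?_
    have h1 : (2⁻¹ : ℝ) ^ n = 2 * v := by rw [hv, pow_succ]; push_cast; ring
    have hvr : (0 : ℝ) < v := hv0
    have h2 : (v : ℝ) ≤ √(v : ℝ) := by
      refine Real.le_sqrt_of_sq_le ?_
      have : (v : ℝ) ≤ 1 := by
        rw [hv]; push_cast; exact pow_le_one₀ (by norm_num) (by norm_num)
      nlinarith
    change c * 2⁻¹ ^ n < √(v : ℝ) * x
    calc c * 2⁻¹ ^ n = v * (2 * c) := by rw [h1]; ring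
      _ ≤ √(v : ℝ) * (2 * c) := by gcongr
      _ < √(v : ℝ) * x := by gcongr
  refine hle.trans_eq ?_
  rw [NNReal.val_eq_coe, NNReal.val_eq_coe, hdist] at hlaw
  rw [hset, ← hlaw.map_eq, Measure.map_apply_of_aemeasurable hlaw.aemeasurable
    measurableSet_Ioi]

theorem IsPreBrownianReal.ae_frequently_geometric_increment (hB : IsPreBrownianReal B P)
    (hm : ∀ t, Measurable (B t)) {c : ℝ} (hc : 0 ≤ c) :
    ∀ᵐ ω ∂P, ∃ᶠ n : ℕ in atTop, c * 2⁻¹ ^ n < B (2⁻¹ ^ (n + 1)) ω - B (2⁻¹ ^ n) ω := by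
  have := hB.isGaussianProcess.isProbabilityMeasure
  let s : ℕ → Set Ω := fun n => {ω | c * 2⁻¹ ^ n < B (2⁻¹ ^ (n + 1)) ω - B (2⁻¹ ^ n) ω}
  have hs : ∀ n, MeasurableSet (s n) := fun n =>
    measurableSet_lt measurable_const ((hm _).sub (hm _))
  have hindep : iIndepSet s P := by
    have h := IsPreBrownianReal.iIndepFun_geometric_increments hB
    rw [iIndepSet_iff_meas_biInter hs]
    intro I
    exact h.measure_inter_preimage_eq_mul I (sets := fun n => Ioi (c * 2⁻¹ ^ n))
      fun n _ => measurableSet_Ioi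
  have hsum : ∑' n, P (s n) = ∞ := by
    refine top_le_iff.1 ((ENNReal.tsum_const_eq_top_of_ne_zero (α := ℕ)
      (gaussianReal_Ioi_pos one_ne_zero 0 (2 * c)).ne').ge.trans (ENNReal.tsum_le_tsum fun n => ?_))
    exact IsPreBrownianReal.le_measure_geometric_increment hB hc n
  have h := measure_limsup_eq_one hs hindep hsum
  have hms : MeasurableSet (limsup s atTop) := .measurableSet_limsup hs
  filter_upwards [(mem_ae_iff_prob_eq_one hms).2 h] with ω hω
  exact mem_limsup_iff_frequently_mem.1 hω

theorem IsPreBrownianReal.exists_measurable_modification (hB : IsPreBrownianReal B P) :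
    ∃ B' : ℝ≥0 → Ω → ℝ, IsPreBrownianReal B' P ∧ (∀ t, Measurable (B' t)) ∧
      ∀ t, B t =ᵐ[P] B' t :=
  ⟨fun t => (hB.aemeasurable t).mk, hB.congr fun t => (hB.aemeasurable t).ae_eq_mk,
    fun t => (hB.aemeasurable t).measurable_mk, fun t => (hB.aemeasurable t).ae_eq_mk⟩

theorem IsBrownianReal.ae_isRegularPath (hW : IsBrownianReal W P) {a : ℝ} (ha : 0 < a) :
    ∀ᵐ ω ∂P, IsRegularPath a fun t => W t ω := by
  obtain ⟨B, hB, hBm, hWB⟩ :=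
    IsPreBrownianReal.exists_measurable_modification hW.toIsPreBrownianReal
  have hae : ∀ᵐ ω ∂P, ∀ n : ℕ, W (2⁻¹ ^ n) ω = B (2⁻¹ ^ n) ω := ae_all_iff.2 fun n => hWB _
  filter_upwards [hW.cont, IsBrownianReal.ae_sublinear hW, hae,
    IsPreBrownianReal.ae_frequently_geometric_increment hB hBm
      -- With `t = 2⁻¹ ^ n` and `s = t / 2`, this slope leaves a gain above `a / 8 * t`.
      (show 0 ≤ (a + 1) / 4 by positivity)] with ω h1 h2 h3 h4
  refine ⟨h1, h2, fun T hT => ?_⟩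
  have htend : Tendsto (fun n : ℕ => (2⁻¹ : ℝ≥0) ^ n) atTop (𝓝 0) :=
    NNReal.tendsto_pow_atTop_nhds_zero_of_lt_one (by norm_num)
  obtain ⟨n, hn, hnT⟩ := (h4.and_eventually (htend.eventually_le_const hT)).exists
  have hle : (2⁻¹ : ℝ≥0) ^ (n + 1) ≤ 2⁻¹ ^ n :=
    pow_le_pow_of_le_one zero_le (by norm_num) (by lia)
  refine ⟨2⁻¹ ^ (n + 1), 2⁻¹ ^ n, by positivity, hle, hnT, ?_⟩
  rw [← h3, ← h3] at hn
  simp only [switchGain, pieceDrift, Even.zero, if_true]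
  push_cast
  have hp : (0 : ℝ) < 2⁻¹ ^ (n + 1) := by positivity
  nlinarith [mul_pos ha hp]

end Brownian

/-! ### Point measures on the half-line -/

section PointMeasure

variable {x : ℕ → Ioi (0 : ℝ)}

theorem sum_dirac_apply_Ici (x : ℕ → Ioi (0 : ℝ)) (b : Ioi (0 : ℝ)) :
    Measure.sum (fun k => Measure.dirac (x k)) (Ici b) = ∑' k, if b ≤ x k then 1 else 0 := by
  rw [Measure.sum_apply _ measurableSet_Ici]
  refine tsum_congr fun k => ?_
  rw [Measure.dirac_apply' _ measurableSet_Ici]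
  rfl

theorem isDiscretePointMeasure_sum_dirac
    (hx : ∀ b : Ioi (0 : ℝ), {k | b ≤ x k}.Finite) :
    IsDiscretePointMeasure (Measure.sum fun k => Measure.dirac (x k)) := by
  have hfib : ∀ y, (x ⁻¹' {y}).Finite := fun y =>
    (hx y).subset fun k (hk : x k = y) => hk.ge
  refine ⟨fun y => (x ⁻¹' {y}).ncard, fun K hK => ?_, ?_⟩
  · rcases K.eq_empty_or_nonempty with rfl | hne
    · simp
    · obtain ⟨b, -, hb⟩ := hK.exists_isMinOn hne continuousOn_id
      refine ((hx b).image x).subset ?_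
      rintro y ⟨hyK, hy⟩
      obtain ⟨k, rfl⟩ := nonempty_of_ncard_ne_zero hy
      exact ⟨k, hb hyK, rfl⟩
  · ext s hs
    rw [Measure.sum_apply _ hs, Measure.sum_apply _ hs,
      ← (Equiv.sigmaFiberEquiv x).tsum_eq, ENNReal.tsum_sigma']
    refine tsum_congr fun y => ?_
    have : ∀ k : {k // x k = y}, Measure.dirac (x (Equiv.sigmaFiberEquiv x ⟨y, k⟩)) s =
        Measure.dirac y s := fun k => by rw [Equiv.sigmaFiberEquiv_apply, k.2]
    simp_rw [this]
    rw [ENNReal.tsum_const, Measure.smul_apply, smul_eq_mul]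
    congr 1
    have : (x ⁻¹' {y}).encard = ((x ⁻¹' {y}).ncard : ℕ∞) := (hfib y).cast_ncard_eq.symm
    rw [show ENat.card {k // x k = y} = (x ⁻¹' {y}).encard from rfl, this]
    rfl

theorem isBoundedFromAbove_sum_dirac {b : Ioi (0 : ℝ)} (hx : ∀ k, x k ≤ b) :
    IsBoundedFromAbove (Measure.sum fun k => Measure.dirac (x k)) := by
  refine ⟨b, ?_⟩
  rw [Measure.sum_apply _ measurableSet_Ioi, ENNReal.tsum_eq_zero]
  intro k
  rw [Measure.dirac_apply' _ measurableSet_Ioi, indicator_of_notMem]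
  exact (hx k).not_gt

/-- There are infinitely many indices but only finitely many with `x k ≥ ε`, so some atom lies in
`(0, ε)`. -/
theorem accumulatesAtZero_sum_dirac (hx : ∀ b : Ioi (0 : ℝ), {k | b ≤ x k}.Finite) :
    AccumulatesAtZero (Measure.sum fun k => Measure.dirac (x k)) := by
  rw [AccumulatesAtZero, accPt_iff_nhds]
  intro U hU
  obtain ⟨ε, hε, hεU⟩ := Metric.mem_nhds_iff.1 hU
  obtain ⟨k, hk⟩ := (hx ⟨ε, hε⟩).infinite_compl.nonempty
  have hk' : (x k : ℝ) < ε := not_le.1 hk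
  have h0 : (0 : ℝ) < x k := (x k).2
  refine ⟨x k, ⟨hεU ?_, x k, ?_, rfl⟩, h0.ne'⟩
  · rw [Metric.mem_ball, dist_zero_right, Real.norm_of_nonneg h0.le]
    exact hk'
  · rw [Set.mem_ofPred_eq, Measure.sum_apply _ (measurableSet_singleton _)]
    refine ne_of_gt (lt_of_lt_of_le ?_ (ENNReal.le_tsum k))
    simp

theorem hitMeasure_univ (a : ℝ) (w : ℝ≥0 → ℝ) (μ : ℝ) :
    hitMeasure a w μ univ = ∑' k, if hitMinus a w μ k ≠ ∞ then 1 else 0 := by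
  rw [hitMeasure, Measure.sum_apply _ .univ]
  refine tsum_congr fun k => ?_
  split_ifs <;> simp_all

/-- A measure on `(0,∞)` which is finite away from `0` is determined by its values on rational
half-lines. -/
theorem measure_ext_of_rat_Ici {m m' : Measure (Ioi (0 : ℝ))}
    (hfin : ∀ b, m (Ici b) ≠ ∞)
    (h : ∀ (q : ℚ) (hq : (0 : ℝ) < q), m (Ici ⟨q, hq⟩) = m' (Ici ⟨q, hq⟩)) : m = m' := by
  let b : ℕ → Ioi (0 : ℝ) := fun n => ⟨((1 / (n + 1) : ℚ) : ℝ), by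
    rw [mem_Ioi]; exact_mod_cast (by positivity : (0 : ℚ) < 1 / (n + 1))⟩
  have hb : Antitone b := fun i j hij => by
    rw [← Subtype.coe_le_coe]
    simp only [b]
    gcongr
  have hcover : ⋃ n, Ici (b n) = univ := by
    refine eq_univ_of_forall fun y => ?_
    obtain ⟨n, hn⟩ := exists_nat_one_div_lt (show (0 : ℝ) < y from y.2)
    refine mem_iUnion.2 ⟨n, ?_⟩
    rw [mem_Ici, ← Subtype.coe_le_coe]
    simp only [b]
    push_cast
    exact hn.le
  have hmono : Monotone fun n => Ici (b n) := fun i j hij => Ici_subset_Ici.2 (hb hij)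
  -- The generating π-system also contains the half-lines of nonpositive rationals, whose trace on
  -- `(0, ∞)` is everything.
  have huniv : m univ = m' univ := by
    rw [← hcover, hmono.measure_iUnion, hmono.measure_iUnion]
    exact iSup_congr fun n => h _ (b n).2
  have hpre : ∀ (q : ℚ) (hq : (0 : ℝ) < q),
      (Subtype.val : Ioi (0 : ℝ) → ℝ) ⁻¹' Ici (q : ℝ) = Ici ⟨q, hq⟩ := fun q hq => rfl
  refine Measure.ext_of_generateFrom_of_iUnion
    (preimage (Subtype.val : Ioi (0 : ℝ) → ℝ) '' ⋃ q : ℚ, {Ici (q : ℝ)}) (fun n => Ici (b n))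
    ?_ ?_ hcover ?_ (fun n => hfin _) ?_
  · rw [← MeasurableSpace.comap_generateFrom, ← Real.borel_eq_generateFrom_Ici_rat]
    rfl
  · exact Real.isPiSystem_Ici_rat.comap _
  · exact fun n => ⟨_, mem_iUnion.2 ⟨1 / (n + 1), rfl⟩, hpre _ (b n).2⟩
  · rintro _ ⟨_, hs, rfl⟩
    obtain ⟨q, rfl⟩ := mem_iUnion.1 hs
    rcases lt_or_ge (0 : ℝ) q with hq | hq
    · rw [hpre q hq, h q hq]
    · rw [show (Subtype.val : Ioi (0 : ℝ) → ℝ) ⁻¹' Ici (q : ℝ) = univ from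
        eq_univ_of_forall fun y => hq.trans (le_of_lt y.2), huniv]

end PointMeasure

/-! ### Measurability of the levels -/

theorem measurableSet_strictReach {Ω : Type*} [MeasurableSpace Ω] {S : Set ℝ≥0}
    (hS : S.Countable) {B : ℝ≥0 → Ω → ℝ} (hB : ∀ t, Measurable (B t)) (a μ : ℝ) (n : ℕ)
    (T : ℝ≥0) : MeasurableSet {ω | StrictReach S a (fun t => B t ω) μ n T} := by
  induction n generalizing T with
  | zero => simp [StrictReach]
  | succ n ih =>
    have : {ω | StrictReach S a (fun t => B t ω) μ (n + 1) T} =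
        ⋃ s ∈ S, ⋃ t ∈ S, {ω | s ≤ t ∧ t ≤ T ∧ StrictReach S a (fun t => B t ω) μ n s ∧
          μ < switchGain a (fun t => B t ω) n s t} := by
      ext ω; simp only [StrictReach, Set.mem_ofPred_eq, mem_iUnion, exists_prop]
    rw [this]
    refine .biUnion hS fun s _ => .biUnion hS fun t _ => ?_
    refine (MeasurableSet.const _).inter ((MeasurableSet.const _).inter ((ih s).inter ?_))
    change MeasurableSet {ω | μ < switchGain a (fun t => B t ω) n s t}
    refine measurableSet_lt measurable_const ?_
    unfold switchGain
    fun_prop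

theorem measurable_excursionLevel {Ω : Type*} [MeasurableSpace Ω] {S : Set ℝ≥0}
    (hS : S.Countable) {B : ℝ≥0 → Ω → ℝ} (hB : ∀ t, Measurable (B t)) (a : ℝ) (k : ℕ) :
    Measurable fun ω => excursionLevel S a (fun t => B t ω) k := by
  classical
  refine Measurable.iSup fun q => Measurable.ite ?_ measurable_const measurable_const
  refine (MeasurableSet.const _).inter ?_
  have : {ω | ∃ T ∈ S, StrictReach S a (fun t => B t ω) q (2 * k + 1) T} =
      ⋃ T ∈ S, {ω | StrictReach S a (fun t => B t ω) q (2 * k + 1) T} := by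
    ext ω; simp
  change MeasurableSet {ω | ∃ T ∈ S, StrictReach S a (fun t => B t ω) q (2 * k + 1) T}
  rw [this]
  exact .biUnion hS fun T _ => measurableSet_strictReach hS hB a q _ T

theorem excursionLevel_congr {S : Set ℝ≥0} {a : ℝ} {w w' : ℝ≥0 → ℝ}
    (h : ∀ s ∈ S, w s = w' s) (k : ℕ) : excursionLevel S a w k = excursionLevel S a w' k := by
  have : ∀ (μ : ℝ) n T, StrictReach S a w μ n T ↔ StrictReach S a w' μ n T := fun μ n T =>
    ⟨fun H => H.congr h, fun H => H.congr fun s hs => (h s hs).symm⟩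
  unfold excursionLevel
  congr! 6
  exact and_congr_right fun _ => this _ _ _

/-- The excursion level as a point of `(0,∞)`, with the value `1` on irregular paths. -/
noncomputable def levelPoint (S : Set ℝ≥0) (a : ℝ) (w : ℝ≥0 → ℝ) (k : ℕ) : Ioi (0 : ℝ) :=
  ⟨if 0 < excursionLevel S a w k then excursionLevel S a w k else 1, by
    rw [mem_Ioi]; split_ifs with h; exacts [h, one_pos]⟩

theorem measurable_levelPoint {Ω : Type*} [MeasurableSpace Ω] {S : Set ℝ≥0}
    (hS : S.Countable) {B : ℝ≥0 → Ω → ℝ} (hB : ∀ t, Measurable (B t)) (a : ℝ) (k : ℕ) :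
    Measurable fun ω => levelPoint S a (fun t => B t ω) k := by
  have h := measurable_excursionLevel hS hB a k
  exact (Measurable.ite (measurableSet_lt measurable_const h) h measurable_const).subtype_mk

theorem measurable_sum_dirac {Ω α : Type*} [MeasurableSpace Ω] [MeasurableSpace α]
    {x : ℕ → Ω → α} (hx : ∀ k, Measurable (x k)) :
    Measurable fun ω => Measure.sum fun k => Measure.dirac (x k ω) := by
  refine Measure.measurable_of_measurable_coe _ fun s hs => ?_
  simp_rw [Measure.sum_apply _ hs]
  exact Measurable.tsum fun k =>
    (Measure.measurable_coe hs).comp (Measure.measurable_dirac.comp (hx k))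

/-! ### Construction and uniqueness of the point process -/

theorem mainTheorem5 {Ω : Type*} [MeasurableSpace Ω] (P : Measure Ω) [IsProbabilityMeasure P]
    (W : ℝ≥0 → Ω → ℝ) (hW : IsBrownianReal W P) (a : ℝ) (ha : 0 < a) :
    ∃ M : Ω → Measure (Ioi (0 : ℝ)),
      IsLimitingPointProcess P W a M ∧
      (∀ M' : Ω → Measure (Ioi (0 : ℝ)), IsLimitingPointProcess P W a M' → M' =ᵐ[P] M) ∧
      ∀ᵐ ω ∂P, IsDiscretePointMeasure (M ω) ∧ IsBoundedFromAbove (M ω) ∧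
        AccumulatesAtZero (M ω) := by
  obtain ⟨S, hSc, hSd⟩ := TopologicalSpace.exists_countable_dense ℝ≥0
  -- The points are built from a modification with measurable coordinates, to make `M` measurable
  -- everywhere; it agrees with `W` on the countable set `S` almost surely, and the levels see only
  -- `S`.
  obtain ⟨B, -, hBm, hWB⟩ :=
    IsPreBrownianReal.exists_measurable_modification hW.toIsPreBrownianReal
  have hreg := IsBrownianReal.ae_isRegularPath hW ha
  have hWB' : ∀ᵐ ω ∂P, ∀ s ∈ S, B s ω = W s ω :=
    (ae_ball_iff hSc).2 fun s _ => (hWB s).symm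
  let x : Ω → ℕ → Ioi (0 : ℝ) := fun ω => levelPoint S a fun t => B t ω
  have hx : ∀ᵐ ω ∂P, IsRegularPath a (fun t => W t ω) ∧
      ∀ k, (x ω k : ℝ) = excursionLevel S a (fun t => W t ω) k := by
    filter_upwards [hreg, hWB'] with ω h1 h2
    refine ⟨h1, fun k => ?_⟩
    rw [← excursionLevel_congr h2]
    refine if_pos ?_
    rw [excursionLevel_congr h2]
    exact h1.excursionLevel_pos ha hSd k
  have hfin : ∀ᵐ ω ∂P, ∀ b, {k | b ≤ x ω k}.Finite := by
    filter_upwards [hx] with ω ⟨h1, h2⟩ b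
    have := h1.finite_le_excursionLevel ha hSd b.2
    simpa only [← h2, Subtype.coe_le_coe] using this
  let M : Ω → Measure (Ioi (0 : ℝ)) := fun ω => Measure.sum fun k => Measure.dirac (x ω k)
  have hM : ∀ᵐ ω ∂P, ∀ b : Ioi (0 : ℝ), M ω (Ici b) = hitMeasure a (fun t => W t ω) b univ := by
    filter_upwards [hx] with ω ⟨h1, h2⟩ b
    rw [sum_dirac_apply_Ici, hitMeasure_univ]
    refine tsum_congr fun k => ?_
    simp only [← Subtype.coe_le_coe, h2, h1.le_excursionLevel_iff_hitMinus ha hSd b.2]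
  refine ⟨M, ⟨measurable_sum_dirac fun k => measurable_levelPoint hSc hBm a k, ?_⟩, ?_, ?_⟩
  · intro k μ _
    filter_upwards [hM] with ω h i using h (μ i)
  · rintro M' ⟨-, hM'⟩
    have hrat : ∀ᵐ ω ∂P, ∀ (q : ℚ) (hq : (0 : ℝ) < q),
        M' ω (Ici ⟨q, hq⟩) = hitMeasure a (fun t => W t ω) q univ := by
      refine ae_all_iff.2 fun q => ae_all_iff.2 fun hq => ?_
      filter_upwards [hM' 1 (fun _ => ⟨q, hq⟩) (Subsingleton.strictMono _)] with ω h using h 0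
    filter_upwards [hM, hrat, hfin] with ω h1 h2 h3
    refine (measure_ext_of_rat_Ici (fun b => ?_) fun q hq => (h1 _).trans (h2 q hq).symm).symm
    rw [sum_dirac_apply_Ici, ← tsum_subtype_eq_of_support_subset (s := {k | b ≤ x ω k})]
    · have := (h3 b).to_subtype
      have := Fintype.ofFinite {k | b ≤ x ω k}
      rw [tsum_fintype]
      refine ENNReal.sum_ne_top.2 fun k _ => ?_
      split_ifs <;> simp
    · intro k hk
      by_contra hn
      exact hk (if_neg hn)
  · filter_upwards [hx, hfin] with ω ⟨h1, h2⟩ h3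
    refine ⟨isDiscretePointMeasure_sum_dirac h3, isBoundedFromAbove_sum_dirac (b := x ω 0) ?_,
      accumulatesAtZero_sum_dirac h3⟩
    intro k
    rw [← Subtype.coe_le_coe, h2, h2]
    exact h1.excursionLevel_le_zero ha hSd k
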